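/- **Lemma.** Let $G_1$ be a group, let $F_1\triangleleft G_1$ be a normal surface subgroup (i.e. $F_1$ is isomorphic to the fundamental group of a compact connected surface, possibly with boundary) with $G_1/F_1\cong\mathbb Z$, and let $G_{\epsilon_1},G_{\epsilon_2}\le G_1$ be infinite cyclic subgroups such that $$G_{\epsilon_1}\cap G_{\epsilon_2}=\{1\},\qquad F_1\cap G_{\epsilon_1}=F_1\cap G_{\epsilon_2}=\{1\}.$$ Let $Q$ be the associated $\mathbb Z_2\times\mathbb Z_2$-symmetric quadrilateral of groups with trivial face group: its vertex groups $G_1,G_2,G_3,G_4$ are copies of $G_1$; its edges $\epsilon_1,\epsilon_2,\epsilon_3,\epsilon_4$ join the vertices $4,1$; $1,2$; $2,3$; $3,4$ respectively; the groups of $\epsilon_1,\epsilon_3$ are copies of $G_{\epsilon_1}$ and those of $\epsilon_2,\epsilon_4$ are copies of $G_{\epsilon_2}$, each included in the two adjacent vertex groups by the corresponding copies of the inclusion into $G_1$. Let $G=\pi_1(Q)$ be the direct limit of this diagram of groups, let $F_i\subset G$ be the image of the copy of $F_1$ in $G_i$, and let $F=\langle F_1,F_2,F_3,F_4\rangle\le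 G$. Then: 1. each vertex group $G_i$ embeds in $G$; 2. $F$ is finitely generated but not finitely presented; in particular $G$ is noncoherent (a group is coherent if all its finitely generated subgroups are finitely presented); 3. put $F_-=\langle F_1,F_2\rangle$ and $F_+=\langle F_3,F_4\rangle$. Then $F_-=F_1*F_2$ and $F_+=F_3*F_4$, both groups are finitely presented, $N:=F_-\cap F_+$ is a free group of infinite rank, and $F=F_-*_N F_+$ (i.e. the natural map from the amalgamated free product to $G$ is injective with image $F$); 4. $H_2(F,\mathbb Z)$ has infinite rank. -/

import Mathlib

universe u

/-- A quadrilateral of groups with trivial face group. The vertices are indexed by `ZMod 4`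
(so that vertex `4` is vertex `0`), the edge `i` joins the vertices `i - 1` and `i`, and every edge
group embeds in the groups of the two vertices of the edge. -/
structure QuadrilateralOfGroups where
  vertexGroup : ZMod 4 → Type u
  edgeGroup : ZMod 4 → Type u
  [vertexGroupGroup : ∀ i, Group (vertexGroup i)]
  [edgeGroupGroup : ∀ i, Group (edgeGroup i)]
  toPrev : ∀ i, edgeGroup i →* vertexGroup (i - 1)
  toNext : ∀ i, edgeGroup i →* vertexGroup i
  toPrev_injective : ∀ i, Function.Injective (toPrev i)
  toNext_injective : ∀ i, Function.Injective (toNext i)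

namespace QuadrilateralOfGroups

attribute [instance] vertexGroupGroup edgeGroupGroup

/-- The relators that identify the two copies of every element of every edge group. -/
def relators (Q : QuadrilateralOfGroups.{u}) : Set (Monoid.CoprodI Q.vertexGroup) :=
  {r | ∃ (i : ZMod 4) (e : Q.edgeGroup i),
    r = Monoid.CoprodI.of (Q.toPrev i e) * (Monoid.CoprodI.of (Q.toNext i e))⁻¹}

/-- The fundamental group of a quadrilateral of groups: the direct limit of the diagram of vertex
groups and edge groups (its universal property is given by `of_toPrev`, `lift`, `lift_of` and
`hom_ext` below). -/
def FundamentalGroup (Q : QuadrilateralOfGroups.{u}) : Type u :=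
  Monoid.CoprodI Q.vertexGroup ⧸ Subgroup.normalClosure Q.relators

noncomputable instance (Q : QuadrilateralOfGroups.{u}) : Group Q.FundamentalGroup :=
  inferInstanceAs (Group (Monoid.CoprodI Q.vertexGroup ⧸ Subgroup.normalClosure Q.relators))

/-- The canonical homomorphism from a vertex group to the fundamental group. -/
noncomputable def of (Q : QuadrilateralOfGroups.{u}) (i : ZMod 4) :
    Q.vertexGroup i →* Q.FundamentalGroup :=
  (QuotientGroup.mk' (Subgroup.normalClosure Q.relators)).comp Monoid.CoprodI.of

theorem of_toPrev (Q : QuadrilateralOfGroups.{u}) (i : ZMod 4) (e : Q.edgeGroup i) :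
    Q.of (i - 1) (Q.toPrev i e) = Q.of i (Q.toNext i e) := by
  refine (QuotientGroup.eq_iff_div_mem (N := Subgroup.normalClosure Q.relators)).2 ?_
  rw [div_eq_mul_inv]
  exact Subgroup.subset_normalClosure ⟨i, e, rfl⟩

/-- Homomorphisms on the vertex groups that agree on the edge groups extend to the fundamental
group. -/
noncomputable def lift (Q : QuadrilateralOfGroups.{u}) {K : Type*} [Group K]
    (f : ∀ i, Q.vertexGroup i →* K)
    (hf : ∀ i e, f (i - 1) (Q.toPrev i e) = f i (Q.toNext i e)) : Q.FundamentalGroup →* K :=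
  QuotientGroup.lift (Subgroup.normalClosure Q.relators) (Monoid.CoprodI.lift f) (by
    have h : Subgroup.normalClosure Q.relators ≤ (Monoid.CoprodI.lift f).ker := by
      refine Subgroup.normalClosure_le_normal ?_
      rintro _ ⟨i, e, rfl⟩
      simp [MonoidHom.mem_ker, hf]
    intro x hx
    exact h hx)

theorem lift_of (Q : QuadrilateralOfGroups.{u}) {K : Type*} [Group K]
    (f : ∀ i, Q.vertexGroup i →* K)
    (hf : ∀ i e, f (i - 1) (Q.toPrev i e) = f i (Q.toNext i e)) (i : ZMod 4)
    (x : Q.vertexGroup i) : Q.lift f hf (Q.of i x) = f i x :=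
  Monoid.CoprodI.lift_of f x

theorem hom_ext (Q : QuadrilateralOfGroups.{u}) {K : Type*} [Group K]
    {f g : Q.FundamentalGroup →* K} (h : ∀ i, f.comp (Q.of i) = g.comp (Q.of i)) : f = g :=
  QuotientGroup.monoidHom_ext (Subgroup.normalClosure Q.relators)
    (Monoid.CoprodI.ext_hom _ _ h)

/-- The `ℤ/2 × ℤ/2`-symmetric quadrilateral of groups given by a group `G₁` and two subgroups
`H₁`, `H₂`: all vertex groups are copies of `G₁`, the groups of the edges `1` and `3` are copies of
`H₁`, those of the edges `2` and `4` are copies of `H₂`, and every edge group embeds in the two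
adjacent vertex groups by (a copy of) the inclusion into `G₁`. -/
def symmetric {G₁ : Type u} [Group G₁] (H₁ H₂ : Subgroup G₁) : QuadrilateralOfGroups.{u} where
  vertexGroup _ := G₁
  edgeGroup i := ↥(if i = 1 ∨ i = 3 then H₁ else H₂)
  toPrev _ := Subgroup.subtype _
  toNext _ := Subgroup.subtype _
  toPrev_injective _ := Subgroup.subtype_injective _
  toNext_injective _ := Subgroup.subtype_injective _

/-- The image in the fundamental group of `symmetric H₁ H₂` of the copy of `F₁` in the `i`-th
vertex group. -/
noncomputable def symmetricCopy {G₁ : Type u} [Group G₁] (H₁ H₂ F₁ : Subgroup G₁) (i : ZMod 4) :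
    Subgroup (symmetric H₁ H₂).FundamentalGroup :=
  F₁.map ((symmetric H₁ H₂).of i)

end QuadrilateralOfGroups

/-- The fundamental group of the closed orientable surface of genus `g`. -/
abbrev OrientableSurfaceGroup (g : ℕ) : Type :=
  PresentedGroup ({(List.ofFn fun i : Fin g =>
    FreeGroup.of (i, false) * FreeGroup.of (i, true) *
      (FreeGroup.of (i, false))⁻¹ * (FreeGroup.of (i, true))⁻¹).prod} : Set (FreeGroup (Fin g × Bool)))

/-- The fundamental group of the closed nonorientable surface that is the connected sum of `k`
projective planes, `1 ≤ k`. -/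
abbrev NonorientableSurfaceGroup (k : ℕ) : Type :=
  PresentedGroup ({(List.ofFn fun i : Fin k => FreeGroup.of i ^ 2).prod} :
    Set (FreeGroup (Fin k)))

/-- Surface groups: the fundamental groups of compact connected surfaces, closed and orientable,
closed and nonorientable, or with nonempty boundary (free of finite rank). -/
def IsSurfaceGroup (S : Type*) [Group S] : Prop :=
  (∃ g : ℕ, Nonempty (S ≃* OrientableSurfaceGroup g)) ∨
  (∃ k : ℕ, 1 ≤ k ∧ Nonempty (S ≃* NonorientableSurfaceGroup k)) ∨
  (∃ n : ℕ, Nonempty (S ≃* FreeGroup (Fin n)))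

/-- A group is coherent if all its finitely generated subgroups are finitely presented. -/
def IsCoherentGroup (G : Type*) [Group G] : Prop :=
  ∀ H : Subgroup G, H.FG → Group.IsFinitelyPresented H

/-- A free group of infinite rank. -/
def IsFreeOfInfiniteRank (N : Type u) [Group N] : Prop :=
  ∃ X : Type u, Infinite X ∧ Nonempty (N ≃* FreeGroup X)

/-- The two members of a pair of subgroups, as a family indexed by `Bool`. -/
def subgroupPair {G : Type*} [Group G] (A B : Subgroup G) (b : Bool) : Subgroup G :=
  cond b A B

/-- The inclusions of `A ⊓ B` into `A` and `B`. -/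
def infInclusion {G : Type*} [Group G] (A B : Subgroup G) (b : Bool) :
    ↥(A ⊓ B) →* ↥(subgroupPair A B b) :=
  Subgroup.inclusion (by cases b; exacts [inf_le_right, inf_le_left])

/-- The natural homomorphism to `G` from the amalgamated free product `A *_{A ∩ B} B` of two
subgroups of `G`. -/
noncomputable def amalgamMap {G : Type*} [Group G] (A B : Subgroup G) :
    Monoid.PushoutI (infInclusion A B) →* G :=
  Monoid.PushoutI.lift (fun b => (subgroupPair A B b).subtype) (A ⊓ B).subtype (fun _ => rfl)

/-- The subgroup `K` is the internal amalgamated free product `A *_{A ∩ B} B` of `A` and `B`. -/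
def IsInternalAmalgam {G : Type*} [Group G] (A B K : Subgroup G) : Prop :=
  Function.Injective (amalgamMap A B) ∧ (amalgamMap A B).range = K

/-- The second homology group `H₂(G, ℤ)` with trivial integer coefficients. -/
noncomputable abbrev integralH2 (G : Type u) [Group G] : Type u :=
  groupHomology (Rep.trivial (ULift.{u} ℤ) G (ULift.{u} ℤ)) 2

/-! Cut the square along the two edges with group `H₁`. Each half is an amalgam `G₁ *_{H₂} G₁` of
two vertex groups. Since `H₁ ⊓ H₂ = ⊥`, the free product `H₁ * H₁` embeds in both halves
(`edgesHom_injective`), and the amalgam of the halves over `H₁ * H₁` embeds in the fundamental group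
(`ofIteratedAmalgam_injective`). Hence the vertex groups embed.

The copies of `F₁` generate the same subgroup `S` in each half; it is their free product because `F₁
⊓ H₂ = ⊥`. Normal forms (`Monoid.PushoutI.amalgamMap_injective`) then show that the two copies of
`S` generate their amalgam over `N`, the trace of `S` on `H₁ * H₁`. So `N` is free, as a subgroup of
a free group. It lies in the kernel of the folding map `H₁ * H₁ → H₁` and contains the difference of
the two copies of `h` whenever `h` is congruent modulo `F₁` to an element of `H₂`. There are
infinitely many such `h` (`infinite_commensurable`), and the wreath product `ℤ ≀ H₁` shows that
these differences are independent in an abelian quotient of `N` (`linearIndependent_lamp`).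

Failure of finite presentability and the size of `H₂(F, ℤ)` both come from one central extension
(`exists_central_extension_of_amalgam`). For `φ : N → M` with `M` abelian, glue `A × M` to `B × M`
along `N × M`, twisting one side by `φ`. The copies of `A` and `B` generate a finitely generated
group `P` that maps onto `A *_N B` with central kernel `L` containing `φ(N)`. If `A *_N B` were
finitely presented, then `L` would be finitely generated. Moreover `L → Pᵃᵇ` has image of finite
rank, and `H₂(A *_N B, ℤ)` maps onto a subgroup of `L` that contains its kernel. -/

namespace Monoid.PushoutI

/-! ### Normal forms in amalgamated products -/

variable {ι : Type*} {G : ι → Type*} {H : Type*} [∀ i, Group (G i)] [Group H]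
  {φ : ∀ i, H →* G i}

/-- If no letter of a word is sent into the base group, then the image of the word in the
amalgamated product lies in the base group only if the word is empty. -/
theorem word_eq_empty_of_lift_mem_range {G' : ι → Type*} [∀ i, Group (G' i)]
    (f : ∀ i, G' i →* G i) (hφ : ∀ i, Function.Injective (φ i)) (w : CoprodI.Word G')
    (hw : ∀ l ∈ w.toList, f l.1 l.2 ∉ (φ l.1).range)
    (h : CoprodI.lift (fun i => (of (φ := φ) i).comp (f i)) w.prod ∈ (base φ).range) :
    w = .empty := by
  let w' : CoprodI.Word G :=
    { toList := w.toList.map fun l => ⟨l.1, f l.1 l.2⟩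
      ne_one := by
        intro l hl
        obtain ⟨l', hl', rfl⟩ := List.mem_map.1 hl
        intro h1
        exact hw l' hl' (by rw [show f l'.1 l'.2 = 1 from h1]; exact one_mem _)
      chain_ne := by
        rw [List.isChain_map]
        exact w.chain_ne }
  have hw' : Reduced φ w' := by
    intro l hl
    obtain ⟨l', hl', rfl⟩ := List.mem_map.1 hl
    exact hw l' hl'
  have hprod : ofCoprodI w'.prod = CoprodI.lift (fun i => (of (φ := φ) i).comp (f i)) w.prod := by
    simp [CoprodI.Word.prod, w', map_list_prod, Function.comp_def]
  have := hw'.eq_empty_of_mem_range hφ (by rwa [hprod])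
  have hl : w'.toList = [] := by rw [this]; rfl
  ext1
  simpa [w'] using hl

/-- A free product of subgroups that meet the base group trivially embeds in the amalgamated
product. -/
theorem coprodI_lift_injective {G' : ι → Type*} [∀ i, Group (G' i)]
    (f : ∀ i, G' i →* G i) (hφ : ∀ i, Function.Injective (φ i))
    (hf : ∀ i g, f i g ∈ (φ i).range → g = 1) :
    Function.Injective (CoprodI.lift fun i => (of (φ := φ) i).comp (f i)) := by
  classical
  rw [injective_iff_map_eq_one]
  intro x hx
  obtain ⟨w, rfl⟩ := CoprodI.Word.equiv.symm.surjective x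
  have : w = .empty := by
    refine word_eq_empty_of_lift_mem_range (φ := φ) f hφ w
      (fun l hl h => w.ne_one l hl (hf _ _ h)) ?_
    rw [show CoprodI.lift (fun i => (of (φ := φ) i).comp (f i)) w.prod = 1 from hx]
    exact one_mem _
  rw [this]
  rfl

/-- An amalgamated product of subgroups embeds in the amalgamated product if the subgroups meet the
base group in the given subgroup. -/
theorem injective_of_comap_range_le {G' : ι → Type*} {H' : Type*} [∀ i, Group (G' i)] [Group H']
    {φ' : ∀ i, H' →* G' i} (f : ∀ i, G' i →* G i) (k : H' →* H)
    (hφ : ∀ i, Function.Injective (φ i)) (hφ' : ∀ i, Function.Injective (φ' i))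
    (hk : Function.Injective k)
    (hf : ∀ i g, f i g ∈ (φ i).range → g ∈ (φ' i).range)
    {K : Type*} [Group K] (j : PushoutI φ →* K) (hj : Function.Injective j)
    (ψ : PushoutI φ' →* K) (hψ : ∀ i g, ψ (of i g) = j (of i (f i g)))
    (hψb : ∀ h, ψ (base φ' h) = j (base φ (k h))) : Function.Injective ψ := by
  classical
  rw [injective_iff_map_eq_one]
  intro x hx
  obtain ⟨d⟩ := NormalWord.transversal_nonempty φ' hφ'
  obtain ⟨w, rfl⟩ := (NormalWord.equiv (d := d)).symm.surjective x
  have hψw : ∀ y, ψ (ofCoprodI y) =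
      j (CoprodI.lift (fun i => (of (φ := φ) i).comp (f i)) y) := by
    intro y
    have : ψ.comp ofCoprodI = j.comp (CoprodI.lift fun i => (of (φ := φ) i).comp (f i)) := by
      ext i g
      simp [hψ]
    exact DFunLike.congr_fun this y
  change ψ w.prod = 1 at hx
  change w.prod = 1
  have hprod : w.prod = base φ' w.head * ofCoprodI w.toWord.prod := rfl
  rw [hprod, map_mul, hψb, hψw, ← map_mul, map_eq_one_iff _ hj] at hx
  have hemp : w.toWord = .empty := by
    refine word_eq_empty_of_lift_mem_range (φ := φ) f hφ w.toWord ?_ ⟨k w.head⁻¹, ?_⟩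
    · intro l hl h
      -- A letter in the base group would factor through the transversal both as itself times `1`
      -- and as `1` times itself, so uniqueness makes it trivial.
      obtain ⟨b, hb⟩ := hf _ _ h
      refine w.ne_one l hl ?_
      have h1 := w.normalized l.1 l.2 hl
      have h2 : l.2 ∈ ((φ' l.1).range : Set (G' l.1)) := ⟨b, hb⟩
      have := (d.compl l.1).existsUnique l.2
      obtain ⟨p, -, hp⟩ := this
      have e1 := hp (⟨l.2, h2⟩, ⟨1, d.one_mem l.1⟩) (by simp)
      have e2 := hp (1, ⟨l.2, h1⟩) (by simp)
      have e3 := e1.trans e2.symm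
      simpa using congrArg (fun q => (q.1 : G' l.1)) e3
    · rw [map_inv, map_inv, inv_eq_iff_mul_eq_one]
      exact hx
  have hone : ofCoprodI (φ := φ') w.toWord.prod = 1 := by rw [hemp]; simp
  rw [hprod, hone, mul_one]
  rw [hemp] at hx
  have : k w.head = 1 := base_injective hφ (by simpa using hx)
  rw [(injective_iff_map_eq_one k).1 hk _ this, map_one]

/-! ### Central extensions of amalgamated products -/

variable {M : Type*} [CommGroup M]

/-- The inclusion of the base group of the central extension, by `M`, of an amalgamated product,
given by homomorphisms from the base group to `M`. -/
def twist (φ : ∀ i, H →* G i) (χ : ι → H →* M) (i : ι) : H × M →* G i × M :=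
  MonoidHom.prod ((φ i).comp (MonoidHom.fst H M))
    ((χ i).comp (MonoidHom.fst H M) * MonoidHom.snd H M)

@[simp]
theorem twist_apply (χ : ι → H →* M) (i : ι) (x : H × M) :
    twist φ χ i x = (φ i x.1, χ i x.1 * x.2) := rfl

theorem twist_injective (hφ : ∀ i, Function.Injective (φ i)) (χ : ι → H →* M) (i : ι) :
    Function.Injective (twist φ χ i) := by
  rintro ⟨a, b⟩ ⟨c, d⟩ h
  simp only [twist_apply, Prod.mk.injEq] at h
  obtain rfl := hφ i h.1
  simpa using h.2

variable (φ) in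
/-- The projection of the central extension to the amalgamated product. -/
def twistProj (χ : ι → H →* M) : PushoutI (twist φ χ) →* PushoutI φ :=
  lift (fun i => (of i).comp (MonoidHom.fst (G i) M)) ((base φ).comp (MonoidHom.fst H M))
    (fun i => by ext x; simp [of_apply_eq_base])

variable (φ) in
/-- The inclusion of the kernel of the central extension. -/
def twistIncl (χ : ι → H →* M) : M →* PushoutI (twist φ χ) :=
  (base (twist φ χ)).comp (MonoidHom.inr H M)

theorem twistIncl_eq_of (χ : ι → H →* M) (i : ι) (m : M) :
    twistIncl φ χ m = of i (1, m) := by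
  simp [twistIncl, ← of_apply_eq_base _ i]

theorem twistIncl_injective (hφ : ∀ i, Function.Injective (φ i)) (χ : ι → H →* M) :
    Function.Injective (twistIncl φ χ) :=
  (base_injective (twist_injective hφ χ)).comp fun _ _ h => (Prod.mk.inj h).2

theorem twistIncl_mem_center (χ : ι → H →* M) (m : M) :
    twistIncl φ χ m ∈ Subgroup.center (PushoutI (twist φ χ)) := by
  rw [Subgroup.mem_center_iff]
  intro x
  induction x using induction_on with
  | of i g =>
    rw [twistIncl_eq_of χ i, ← map_mul, ← map_mul]
    exact congrArg _ (Prod.ext (by simp) (mul_comm _ _))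
  | base h =>
    rw [twistIncl, MonoidHom.comp_apply, ← map_mul, ← map_mul]
    exact congrArg _ (Prod.ext (by simp) (mul_comm _ _))
  | mul x y hx hy => rw [mul_assoc, hy, ← mul_assoc, hx, mul_assoc]

/-- Modulo the central subgroup `M` the twist disappears, so `g ↦ (g, 1)` defines a map `σ` from the
untwisted amalgam to the quotient. Composed with the projection it is the quotient map, which bounds
the kernel. -/
theorem twistProj_ker (χ : ι → H →* M) : (twistProj φ χ).ker = (twistIncl φ χ).range := by
  have hcen : (twistIncl φ χ).range ≤ Subgroup.center _ := by
    rintro _ ⟨m, rfl⟩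
    exact twistIncl_mem_center χ m
  have : (twistIncl φ χ).range.Normal := ⟨fun x hx g => by
    rwa [(Subgroup.mem_center_iff.1 (hcen hx) g), mul_inv_cancel_right]⟩
  let q := QuotientGroup.mk' (twistIncl φ χ).range
  have hq : ∀ m, q (twistIncl φ χ m) = 1 := fun m => (QuotientGroup.eq_one_iff _).2 ⟨m, rfl⟩
  refine le_antisymm ?_ ?_
  · let σ : PushoutI φ →* PushoutI (twist φ χ) ⧸ (twistIncl φ χ).range :=
      lift (fun i => q.comp ((of i).comp (MonoidHom.inl (G i) M)))
        (q.comp ((base _).comp (MonoidHom.inl H M))) (fun i => by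
          ext h
          have : (φ i h, (1 : M)) = twist φ χ i (h, 1) * (1, (χ i h)⁻¹) := by simp
          simp only [MonoidHom.comp_apply, MonoidHom.inl_apply]
          rw [this, map_mul, of_apply_eq_base, ← twistIncl_eq_of, map_mul, hq, mul_one])
    have hσ : σ.comp (twistProj φ χ) = q := by
      refine hom_ext (fun i => ?_) ?_
      · refine MonoidHom.ext fun x => ?_
        obtain ⟨g, m⟩ := x
        have : ((g, m) : G i × M) = (g, 1) * (1, m) := by simp
        simp only [MonoidHom.comp_apply, twistProj, lift_of, σ, MonoidHom.coe_fst,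
          MonoidHom.inl_apply]
        rw [this, map_mul, ← twistIncl_eq_of, map_mul, hq, mul_one]
      · refine MonoidHom.ext fun x => ?_
        obtain ⟨h, m⟩ := x
        have : ((h, m) : H × M) = (h, 1) * (1, m) := by simp
        simp only [MonoidHom.comp_apply, twistProj, lift_base, σ, MonoidHom.coe_fst,
          MonoidHom.inl_apply]
        rw [this, map_mul, map_mul]
        change _ = _ * q (twistIncl φ χ m)
        rw [hq, mul_one]
    intro x hx
    rw [← QuotientGroup.eq_one_iff]
    change q x = 1
    rw [← hσ, MonoidHom.comp_apply, (MonoidHom.mem_ker.1 hx), map_one]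
  · rintro _ ⟨m, rfl⟩
    simp [MonoidHom.mem_ker, twistIncl, twistProj]

end Monoid.PushoutI

/-! ### Central extensions and finite presentability -/

/-- The kernel of a homomorphism from a finitely generated group onto a finitely presented group is
finitely generated as a normal subgroup. -/
theorem MonoidHom.ker_isFinitelyNormallyGenerated {P K : Type*} [Group P] [Group K]
    [hP : Group.FG P] [hK : Group.IsFinitelyPresented K] (π : P →* K)
    (hπ : Function.Surjective π) : π.ker.IsFinitelyNormallyGenerated := by
  obtain ⟨n, ψ, hψ, S, hS, hSψ⟩ := hK.out
  obtain ⟨T, hT⟩ := hP.out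
  choose s hs using hπ
  let lam : FreeGroup (Fin n) →* P := FreeGroup.lift fun i => s (ψ (FreeGroup.of i))
  have hlam : π.comp lam = ψ := by
    ext i
    simp [lam, hs]
  have hlam' : ∀ w, π (lam w) = ψ w := fun w => DFunLike.congr_fun hlam w
  choose v hv using hψ
  -- Lifts of the relators of `K`, together with elements that rewrite each generator of `P` as a
  -- word in the lifted generators of `K`. Modulo `S'` the map `lam` becomes onto and factors
  -- through `K`.
  let S' : Set P := lam '' S ∪ (fun t => t * (lam (v (π t)))⁻¹) '' (T : Set P)
  have hS' : Subgroup.normalClosure S' ≤ π.ker := by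
    refine Subgroup.normalClosure_le_normal ?_
    rintro _ (⟨w, hw, rfl⟩ | ⟨t, -, rfl⟩)
    · have : w ∈ ψ.ker := hSψ ▸ Subgroup.subset_normalClosure hw
      simpa [MonoidHom.mem_ker, hlam'] using this
    · simp [MonoidHom.mem_ker, hlam', hv]
  refine ⟨S', (hS.image _).union (T.finite_toSet.image _), le_antisymm hS' ?_⟩
  let q := QuotientGroup.mk' (Subgroup.normalClosure S')
  have hq : ∀ x, q x = 1 ↔ x ∈ Subgroup.normalClosure S' := fun x => QuotientGroup.eq_one_iff x
  have hker : ψ.ker ≤ (q.comp lam).ker := by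
    rw [← hSψ]
    refine Subgroup.normalClosure_le_normal fun w hw => ?_
    exact (hq _).2 (Subgroup.subset_normalClosure (Or.inl ⟨w, hw, rfl⟩))
  have hrange : ∀ x : P, q x ∈ (q.comp lam).range := by
    intro x
    have hx : x ∈ Subgroup.closure (T : Set P) := hT ▸ Subgroup.mem_top x
    induction hx using Subgroup.closure_induction with
    | mem t ht =>
      refine ⟨v (π t), ?_⟩
      have : q (t * (lam (v (π t)))⁻¹) = 1 :=
        (hq _).2 (Subgroup.subset_normalClosure (Or.inr ⟨t, ht, rfl⟩))
      rw [map_mul, map_inv, mul_inv_eq_one] at this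
      exact this.symm
    | one => simp
    | mul x y _ _ hx hy => rw [map_mul]; exact mul_mem hx hy
    | inv x _ hx => rw [map_inv]; exact inv_mem hx
  intro x hx
  obtain ⟨w, hw⟩ := hrange x
  have hmem : (lam w)⁻¹ * x ∈ Subgroup.normalClosure S' := by
    rw [← hq, map_mul, map_inv, ← hw]
    simp
  have h1 := MonoidHom.mem_ker.1 (hS' hmem)
  rw [map_mul, map_inv, hlam', MonoidHom.mem_ker.1 hx, mul_one, inv_eq_one] at h1
  rw [← hq, ← hw]
  exact hker h1

/-- A central subgroup that is finitely generated as a normal subgroup is finitely generated. -/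
theorem Subgroup.IsFinitelyNormallyGenerated.fg_of_le_center {P : Type*} [Group P]
    {Z : Subgroup P} (hZ : Z.IsFinitelyNormallyGenerated) (hc : Z ≤ Subgroup.center P) : Z.FG := by
  obtain ⟨S, hS, rfl⟩ := hZ
  have hSc : Subgroup.closure S ≤ Subgroup.center P :=
    (Subgroup.closure_le_normalClosure).trans hc
  have : (Subgroup.closure S).Normal := ⟨fun x hx g => by
    rwa [(Subgroup.mem_center_iff.1 (hSc hx) g), mul_inv_cancel_right]⟩
  rw [show Subgroup.normalClosure S = Subgroup.closure S from
    le_antisymm (Subgroup.normalClosure_le_normal Subgroup.subset_closure)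
      Subgroup.closure_le_normalClosure]
  exact (Subgroup.fg_iff _).2 ⟨S, rfl, hS⟩

theorem rank_additive_lt_aleph0 {L : Type*} [CommGroup L] [Group.FG L] :
    Module.rank ℤ (Additive L) < Cardinal.aleph0 := by
  have : Module.Finite ℤ (Additive L) := Module.Finite.iff_addGroup_fg.2 inferInstance
  exact Module.rank_lt_aleph0 ℤ _

/-- A quotient of a finitely generated group by a central subgroup of infinite rank is not finitely
presented. -/
theorem not_isFinitelyPresented_of_central_extension {L P K : Type*} [CommGroup L] [Group P]
    [Group K] [Group.FG P] (z : L →* P) (π : P →* K) (hz : Function.Injective z)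
    (hπ : Function.Surjective π) (hker : π.ker = z.range) (hc : z.range ≤ Subgroup.center P)
    (hL : Cardinal.aleph0 ≤ Module.rank ℤ (Additive L)) : ¬ Group.IsFinitelyPresented K := by
  intro hK
  have h := (π.ker_isFinitelyNormallyGenerated hπ).fg_of_le_center (hker ▸ hc)
  rw [hker] at h
  have : Group.FG z.range := (Group.fg_iff_subgroup_fg _).2 h
  have : Group.FG L := Group.fg_of_surjective (f := (MonoidHom.ofInjective hz).symm.toMonoidHom)
    (MonoidHom.ofInjective hz).symm.surjective
  exact absurd hL (not_le.2 rank_additive_lt_aleph0)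

/-! ### Second homology of a central quotient -/

open groupHomology in
/-- If a central extension of `K` is given, then a homomorphism from `H₂(K, ℤ)` to the kernel
attains all elements of the kernel that are products of commutators. -/
theorem exists_integralH2_hom_of_central_extension {L P K : Type u} [CommGroup L] [Group P]
    [Group K] (z : L →* P) (π : P →* K) (hz : Function.Injective z)
    (hπ : Function.Surjective π) (hker : π.ker = z.range) (hc : z.range ≤ Subgroup.center P) :
    ∃ γ : integralH2 K →+ Additive L,
      ∀ l : L, z l ∈ commutator P → Additive.ofMul l ∈ γ.range := by
  let A : Rep.{u} (ULift.{u} ℤ) K := Rep.trivial (ULift.{u} ℤ) K (ULift.{u} ℤ)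
  choose s hs using hπ
  have hcen : ∀ l x, x * z l = z l * x := fun l =>
    Subgroup.mem_center_iff.1 (hc ⟨l, rfl⟩)
  have hex : ∀ x : P, ∃ l : L, x = z l * s (π x) := by
    intro x
    have : x * (s (π x))⁻¹ ∈ π.ker := by simp [MonoidHom.mem_ker, hs]
    rw [hker] at this
    obtain ⟨l, hl⟩ := this
    exact ⟨l, by simp [hl]⟩
  choose a ha using hex
  -- The 2-cocycle of the extension for the section `s`. Extended linearly to bar 2-chains, it kills
  -- boundaries and so induces `γ`.
  let c : K → K → L := fun g h => a (s g * s h)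
  have hcs : ∀ g h, s g * s h = z (c g h) * s (g * h) := by
    intro g h
    have := ha (s g * s h)
    rwa [map_mul, hs, hs] at this
  have huniq : ∀ (l l' : L) (g : K), z l * s g = z l' * s g → l = l' := fun l l' g h =>
    hz (mul_right_cancel h)
  have hcoc : ∀ g h j, c h j * c g (h * j) = c (g * h) j * c g h := by
    intro g h j
    refine huniq _ _ (g * (h * j)) ?_
    trans s g * (s h * s j)
    · rw [map_mul, mul_assoc, ← hcs, hcs h j, ← mul_assoc, ← hcen, mul_assoc]
    · rw [mul_comm (c (g * h) j), map_mul, ← mul_assoc g, mul_assoc, ← hcs, ← mul_assoc, hcs g h,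
        mul_assoc]
  have hamul : ∀ x y, a (x * y) = a x * a y * c (π x) (π y) := by
    intro x y
    refine huniq _ _ (π (x * y)) ?_
    rw [← ha (x * y)]
    conv_lhs => rw [ha x, ha y]
    rw [map_mul, map_mul, map_mul, mul_assoc, mul_assoc, ← hcs, ← mul_assoc (s (π x)), hcen]
    simp only [mul_assoc]
  let γ₀ : (K × K →₀ ULift.{u} ℤ) →+ Additive L :=
    Finsupp.liftAddHom fun g =>
      ((zmultiplesHom (Additive L)) (Additive.ofMul (c g.1 g.2))).comp
        (AddEquiv.ulift (α := ℤ)).toAddMonoidHom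
  have hγ₀ : ∀ g h (r : ULift.{u} ℤ), γ₀ (Finsupp.single (g, h) r) =
      r.down • Additive.ofMul (c g h) := by
    intro g h r
    simp only [γ₀, Finsupp.liftAddHom_apply_single]
    rfl
  have hd32 : γ₀.comp (d₃₂ A).hom.toAddMonoidHom = 0 := by
    refine Finsupp.addHom_ext fun g r => ?_
    obtain ⟨g, h, j⟩ := g
    have e : (d₃₂ A).hom (Finsupp.single (g, h, j) r) = _ := d₃₂_single (A := A) (g, h, j) r
    have hρ : A.ρ g⁻¹ r = r := rfl
    have hc' : Additive.ofMul (c h j) + Additive.ofMul (c g (h * j)) =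
      Additive.ofMul (c (g * h) j) + Additive.ofMul (c g h) := hcoc g h j
    change γ₀ ((d₃₂ A).hom (Finsupp.single (g, h, j) r)) = 0
    rw [e]
    simp only [map_sub, map_add, hρ]
    erw [hγ₀, hγ₀, hγ₀, hγ₀]
    rw [sub_add_eq_add_sub, ← smul_add, hc', smul_add]
    abel
  let γ₁ : cycles₂ A →+ Additive L := γ₀.comp (cycles₂ A).subtype.toAddMonoidHom
  let p : cycles₂ A →+ integralH2 K := (H2π A).hom.toAddMonoidHom
  have hp : Function.Surjective p := by
    intro x
    induction x using H2_induction_on with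
    | h x => exact ⟨x, rfl⟩
  have hpγ : p.ker ≤ γ₁.ker := by
    intro x hx
    obtain ⟨y, hy⟩ := (H2π_eq_zero_iff (A := A) x).1 hx
    change γ₀ x.1 = 0
    rw [← hy]
    exact DFunLike.congr_fun hd32 y
  refine ⟨p.liftOfSurjective hp ⟨γ₁, hpγ⟩, fun l hl => ?_⟩
  have key : ∀ l, z l ∈ commutator P → ∃ w : K × K →₀ ULift.{u} ℤ,
      (d₂₁ A).hom w = (Finsupp.single (1 : K) (1 : ULift.{u} ℤ) : K →₀ ULift.{u} ℤ) ∧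
        -γ₀ w = Additive.ofMul (a (z l)) := by
    -- Dividing by the range of `D` imposes exactly the relations that make `x ↦ (π x, a x)` a
    -- homomorphism. Its target is abelian, so it kills commutators; this produces the 2-chain `w`.
    let D : (K × K →₀ ULift.{u} ℤ) →+ (K →₀ ULift.{u} ℤ) × Additive L :=
      (d₂₁ A).hom.toAddMonoidHom.prod (-γ₀)
    let q := QuotientAddGroup.mk' D.range
    let Θ : P →* Multiplicative (((K →₀ ULift.{u} ℤ) × Additive L) ⧸ D.range) :=
      MonoidHom.mk' (fun x => Multiplicative.ofAdd
        (q (Finsupp.single (π x) 1, Additive.ofMul (a x)))) (by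
        intro x y
        rw [← ofAdd_add, ← map_add]
        congr 1
        refine (QuotientAddGroup.eq (s := D.range)).2 ⟨Finsupp.single (π x, π y) 1, ?_⟩
        have e : (d₂₁ A).hom (Finsupp.single (π x, π y) (1 : ULift.{u} ℤ)) = _ :=
          d₂₁_single (A := A) (π x, π y) (1 : ULift.{u} ℤ)
        have hρ : A.ρ (π x)⁻¹ (1 : ULift.{u} ℤ) = (1 : ULift.{u} ℤ) := rfl
        refine Prod.ext ?_ ?_
        · change (d₂₁ A).hom (Finsupp.single (π x, π y) (1 : ULift.{u} ℤ)) = _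
          rw [e]
          simp only [hρ, map_mul]
          change _ = -(Finsupp.single (π x * π y) (1 : ULift.{u} ℤ) : K →₀ ULift.{u} ℤ) +
            (Finsupp.single (π x) 1 + Finsupp.single (π y) 1)
          have habel : ∀ u₁ u₂ u₃ : K →₀ ULift.{u} ℤ, u₃ - u₁ + u₂ = -u₁ + (u₂ + u₃) := by
            intros; abel
          exact habel _ _ _
        · change -γ₀ (Finsupp.single (π x, π y) (1 : ULift.{u} ℤ)) =
            -Additive.ofMul (a (x * y)) + (Additive.ofMul (a x) + Additive.ofMul (a y))
          rw [hγ₀, hamul, ofMul_mul, ofMul_mul]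
          change -((1 : ℤ) • _) = _
          rw [one_smul]
          abel)
    intro l hl
    have h1 : Θ (z l) = 1 := MonoidHom.mem_ker.1 (Abelianization.commutator_subset_ker
      (A := Multiplicative (((K →₀ ULift.{u} ℤ) × Additive L) ⧸ D.range)) Θ hl)
    have h2 : (Finsupp.single (π (z l)) 1, Additive.ofMul (a (z l))) ∈ D.range :=
      (QuotientAddGroup.eq_zero_iff _).1 h1
    obtain ⟨w, hw⟩ := h2
    have h3 : π (z l) = 1 := by
      rw [← MonoidHom.mem_ker, hker]
      exact ⟨l, rfl⟩
    rw [h3] at hw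
    exact ⟨w, (Prod.ext_iff.1 hw).1, (Prod.ext_iff.1 hw).2⟩
  -- The section is not normalised, so `a (z l)` is `l` times the constant `a (z 1)`. Comparing with
  -- the chain for `l = 1` removes the constant and makes the difference a cycle.
  obtain ⟨w₀, hw₀, hw₀'⟩ := key 1 (by rw [map_one]; exact one_mem _)
  obtain ⟨w, hw, hw'⟩ := key l hl
  let x : cycles₂ A := ⟨w₀ - w, by
    rw [cycles₂, LinearMap.mem_ker]
    erw [map_sub]
    rw [hw₀, hw, sub_self]⟩
  refine ⟨p x, ?_⟩
  rw [AddMonoidHom.liftOfRightInverse_comp_apply]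
  change γ₀ (w₀ - w) = _
  have h4 : a (z l) = l * a (z 1) := by
    refine huniq _ _ 1 ?_
    have e1 := ha (z l)
    have e0 := ha (z 1)
    have h3 : ∀ l, π (z l) = 1 := fun l => by
      rw [← MonoidHom.mem_ker, hker]
      exact ⟨l, rfl⟩
    rw [h3] at e1 e0
    rw [← e1, map_mul, mul_assoc, ← e0, map_one, mul_one]
  rw [map_sub]
  rw [h4, ofMul_mul, ← hw₀'] at hw'
  rw [sub_eq_add_neg, hw']
  abel

/-- If a finitely generated group is a central extension of `K` with kernel of infinite rank, then
`H₂(K, ℤ)` has infinite rank. -/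
theorem aleph0_le_rank_integralH2_of_central_extension {L P K : Type u} [CommGroup L] [Group P]
    [Group K] [Group.FG P] (z : L →* P) (π : P →* K) (hz : Function.Injective z)
    (hπ : Function.Surjective π) (hker : π.ker = z.range) (hc : z.range ≤ Subgroup.center P)
    (hL : Cardinal.aleph0 ≤ Module.rank ℤ (Additive L)) :
    Cardinal.aleph0 ≤ Module.rank ℤ (integralH2 K) := by
  obtain ⟨γ, hγ⟩ := exists_integralH2_hom_of_central_extension z π hz hπ hker hc
  let α : Additive L →ₗ[ℤ] Additive (Abelianization P) :=
    (MonoidHom.toAdditive (Abelianization.of.comp z)).toIntLinearMap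
  have h1 := α.rank_range_add_rank_ker
  have : Group.FG (Abelianization P) := QuotientGroup.fg _
  have h2 : Module.rank ℤ (LinearMap.range α) < Cardinal.aleph0 :=
    (Submodule.rank_le _).trans_lt rank_additive_lt_aleph0
  have h3 : Cardinal.aleph0 ≤ Module.rank ℤ (LinearMap.ker α) := by
    by_contra h
    rw [← h1] at hL
    exact absurd hL (not_le.2 (Cardinal.add_lt_aleph0 h2 (not_le.1 h)))
  have h4 : LinearMap.ker α ≤ LinearMap.range γ.toIntLinearMap := by
    intro l hl
    refine hγ l.toMul ?_
    rw [← Abelianization.ker_of]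
    exact hl
  exact h3.trans ((Submodule.rank_mono h4).trans (rank_range_le _))

open Monoid

/-! ### The lamplighter homomorphism -/

/-- The translation action of a group on its free abelian group. -/
noncomputable def translationAut (H : Type*) [Group H] :
    H →* MulAut (Multiplicative (H →₀ ℤ)) where
  toFun h := AddEquiv.toMultiplicative (Finsupp.domCongr (Equiv.mulLeft h))
  map_one' := by
    refine MulEquiv.ext fun x => ?_
    change Multiplicative.ofAdd (Finsupp.domCongr (Equiv.mulLeft 1) x.toAdd) = x
    refine congrArg Multiplicative.ofAdd (Finsupp.ext fun j => ?_)
    change x.toAdd (1⁻¹ * j) = x.toAdd j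
    simp
  map_mul' g h := by
    refine MulEquiv.ext fun x => ?_
    change Multiplicative.ofAdd (Finsupp.domCongr (Equiv.mulLeft (g * h)) x.toAdd) =
      Multiplicative.ofAdd (Finsupp.domCongr (Equiv.mulLeft g)
        (Finsupp.domCongr (Equiv.mulLeft h) x.toAdd))
    refine congrArg Multiplicative.ofAdd (Finsupp.ext fun j => ?_)
    change x.toAdd ((g * h)⁻¹ * j) = x.toAdd (h⁻¹ * (g⁻¹ * j))
    simp [mul_assoc]

/-- The lamp at `h`. -/
noncomputable def lamp {H : Type*} [Group H] (h : H) : Multiplicative (H →₀ ℤ) :=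
  Multiplicative.ofAdd (Finsupp.single h 1)

theorem translationAut_lamp {H : Type*} [Group H] (g h : H) :
    translationAut H g (lamp h) = lamp (g * h) := by
  change Multiplicative.ofAdd (Finsupp.domCongr (Equiv.mulLeft g) (Finsupp.single h 1)) = _
  simp [lamp, Finsupp.domCongr_apply]

/-- The homomorphism from the free product of two copies of `H` to the wreath product `ℤ ≀ H` that
is the inclusion on the second copy and its conjugate by a lamp on the first copy. -/
noncomputable def lamplighterHom (H : Type*) [Group H] :
    CoprodI (fun _ : Bool => H) →* Multiplicative (H →₀ ℤ) ⋊[translationAut H] H :=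
  CoprodI.lift fun b => cond b
    ((MulAut.conj (SemidirectProduct.inl (lamp 1))).toMonoidHom.comp SemidirectProduct.inr)
    SemidirectProduct.inr

theorem lamplighterHom_right {H : Type*} [Group H] (c : CoprodI fun _ : Bool => H) :
    (lamplighterHom H c).right = CoprodI.lift (fun _ => MonoidHom.id H) c := by
  have : SemidirectProduct.rightHom.comp (lamplighterHom H) =
      CoprodI.lift (fun _ => MonoidHom.id H) := by
    refine CoprodI.ext_hom _ _ fun b => ?_
    ext h
    cases b <;> simp [lamplighterHom]
  exact DFunLike.congr_fun this c

/-- The element goes to the commutator of the lamp at `1` with `h`. -/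
theorem lamplighterHom_left {H : Type*} [Group H] (h : H) :
    (lamplighterHom H (CoprodI.of (i := true) h * (CoprodI.of (i := false) h)⁻¹)).left =
      lamp 1 * (lamp h)⁻¹ := by
  simp [lamplighterHom, translationAut_lamp]

/-- The restriction of the lamplighter homomorphism to a subgroup of the kernel of the folding
homomorphism, as a homomorphism to the group of lamps. -/
noncomputable def lampHom {H N : Type*} [Group H] [Group N]
    (j : N →* CoprodI (fun _ : Bool => H))
    (hj : ∀ n, CoprodI.lift (fun _ => MonoidHom.id H) (j n) = 1) :
    N →* Multiplicative (H →₀ ℤ) :=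
  MonoidHom.mk' (fun n => (lamplighterHom H (j n)).left) fun a b => by
    simp [lamplighterHom_right, hj]

/-- Restricting to the coordinates in `D` forgets the lamp at `1` and leaves the negatives of the
standard basis vectors. -/
theorem linearIndependent_lamp {H : Type*} [Group H] (D : Set H) (hD : 1 ∉ D) :
    LinearIndependent ℤ fun d : D => Additive.ofMul (lamp 1 * (lamp (d : H))⁻¹) := by
  let g : Additive (Multiplicative (H →₀ ℤ)) →+ (D →₀ ℤ) :=
    (Finsupp.lcomapDomain (R := ℤ) (M := ℤ) (Subtype.val : D → H)
      Subtype.val_injective).toAddMonoidHom.comp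
        (AddEquiv.additiveMultiplicative (H →₀ ℤ)).toAddMonoidHom
  let f : Additive (Multiplicative (H →₀ ℤ)) →ₗ[ℤ] (D →₀ ℤ) :=
    { g with map_smul' := fun n x => map_zsmul g n x }
  refine LinearIndependent.of_comp f ?_
  have hf : f ∘ (fun d : D => Additive.ofMul (lamp 1 * (lamp (d : H))⁻¹)) =
      fun d : D => -Finsupp.single d (1 : ℤ) := by
    ext d e
    classical
    have : (1 : H) ≠ e := fun h => hD (h ▸ e.2)
    change (Finsupp.single (1 : H) (1 : ℤ) + -Finsupp.single (d : H) (1 : ℤ) : H →₀ ℤ) (e : H) = _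
    simp [Finsupp.single_apply, this, Subtype.ext_iff]
  rw [hf]
  exact (Finsupp.linearIndependent_single_one ℤ D).neg

/-! ### Amalgamated products of finitely generated groups -/

theorem amalgamMap_of {G : Type*} [Group G] (A B : Subgroup G) (b : Bool)
    (g : subgroupPair A B b) : amalgamMap A B (PushoutI.of b g) = g :=
  PushoutI.lift_of _ _ _ _

theorem amalgamMap_base {G : Type*} [Group G] (A B : Subgroup G) (g : ↥(A ⊓ B)) :
    amalgamMap A B (PushoutI.base _ g) = g :=
  PushoutI.lift_base _ _ _ _

theorem amalgamMap_range {G : Type*} [Group G] (A B : Subgroup G) :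
    (amalgamMap A B).range = A ⊔ B := by
  refine le_antisymm ?_ (sup_le ?_ ?_)
  · rintro _ ⟨x, rfl⟩
    induction x using PushoutI.induction_on with
    | of b g =>
      rw [amalgamMap_of]
      cases b
      · exact Subgroup.mem_sup_right g.2
      · exact Subgroup.mem_sup_left g.2
    | base h =>
      rw [amalgamMap_base]
      exact Subgroup.mem_sup_left h.2.1
    | mul x y hx hy => rw [map_mul]; exact mul_mem hx hy
  · intro a ha
    exact ⟨PushoutI.of true (⟨a, ha⟩ : ↥(subgroupPair A B true)), amalgamMap_of A B _ _⟩
  · intro a ha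
    exact ⟨PushoutI.of false (⟨a, ha⟩ : ↥(subgroupPair A B false)), amalgamMap_of A B _ _⟩

theorem infInclusion_injective {G : Type*} [Group G] (A B : Subgroup G) (b : Bool) :
    Function.Injective (infInclusion A B b) :=
  Subgroup.inclusion_injective _

/-- An amalgamated product of two finitely generated groups, such that the amalgamated subgroup has
an abelian quotient of infinite rank, is the quotient of a finitely generated group by a central
subgroup of infinite rank. -/
theorem exists_central_extension_of_amalgam {G M : Type u} [Group G] [CommGroup M]
    {A B : Subgroup G} (hA : A.FG) (hB : B.FG) (hinj : Function.Injective (amalgamMap A B))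
    (φ : ↥(A ⊓ B) →* M) {D : Type u} [Infinite D] (v : D → ↥(A ⊓ B))
    (hv : LinearIndependent ℤ fun d => Additive.ofMul (φ (v d))) :
    ∃ (L P : Type u) (_ : CommGroup L) (_ : Group P) (z : L →* P)
      (π : P →* (amalgamMap A B).range), Group.FG P ∧ Function.Injective z ∧
      Function.Surjective π ∧ π.ker = z.range ∧ z.range ≤ Subgroup.center P ∧
      Cardinal.aleph0 ≤ Module.rank ℤ (Additive L) := by
  -- Only the gluing on the side of `B` is twisted.
  let χ : Bool → ↥(A ⊓ B) →* M := fun b => cond b 1 φ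
  let ψ := infInclusion A B
  have hψ : ∀ b, Function.Injective (ψ b) := infInclusion_injective A B
  let P : Subgroup (PushoutI (PushoutI.twist ψ χ)) :=
    ⨆ b, ((PushoutI.of b).comp (MonoidHom.inl (subgroupPair A B b) M)).range
  have hofP : ∀ b (g : subgroupPair A B b), PushoutI.of b (g, (1 : M)) ∈ P := fun b g =>
    Subgroup.mem_iSup_of_mem b ⟨g, rfl⟩
  have hP : Group.FG P := by
    rw [Group.fg_iff_subgroup_fg]
    refine Subgroup.FG.iSup _ fun b => ?_
    have : Group.FG (subgroupPair A B b) := by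
      rw [Group.fg_iff_subgroup_fg]
      cases b
      · exact hB
      · exact hA
    rw [← Group.fg_iff_subgroup_fg]
    infer_instance
  let L : Subgroup M := P.comap (PushoutI.twistIncl ψ χ)
  let z : L →* P := ((PushoutI.twistIncl ψ χ).comp L.subtype).codRestrict P fun l => l.2
  let π : P →* (amalgamMap A B).range :=
    (amalgamMap A B).rangeRestrict.comp ((PushoutI.twistProj ψ χ).comp P.subtype)
  have hφL : ∀ n, φ n ∈ L := by
    intro n
    -- The lifts of `n` through `A` and through `B` both lie in `P`; because of the twist they
    -- differ by the central element `φ n`.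
    have h : PushoutI.twistIncl ψ χ (φ n) =
        PushoutI.of true (ψ true n, (1 : M)) * (PushoutI.of false (ψ false n, (1 : M)))⁻¹ := by
      have h1 : PushoutI.of true (ψ true n, (1 : M)) =
          PushoutI.base (PushoutI.twist ψ χ) (n, 1) := by
        rw [← PushoutI.of_apply_eq_base _ true]
        simp [χ]
      have h2 : PushoutI.of false (ψ false n, (1 : M)) =
          PushoutI.base (PushoutI.twist ψ χ) (n, (φ n)⁻¹) := by
        rw [← PushoutI.of_apply_eq_base _ false]
        simp [χ]
      rw [h1, h2, PushoutI.twistIncl, MonoidHom.comp_apply, ← map_inv, ← map_mul]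
      simp
    change PushoutI.twistIncl ψ χ (φ n) ∈ P
    rw [h]
    exact mul_mem (hofP _ _) (inv_mem (hofP _ _))
  refine ⟨L, P, inferInstance, inferInstance, z, π, hP, ?_, ?_, ?_, ?_, ?_⟩
  · intro a b h
    exact Subtype.ext (PushoutI.twistIncl_injective hψ χ (congrArg Subtype.val h))
  · rintro ⟨_, x, rfl⟩
    suffices ∃ p ∈ P, PushoutI.twistProj ψ χ p = x by
      obtain ⟨p, hp, rfl⟩ := this
      exact ⟨⟨p, hp⟩, rfl⟩
    induction x using PushoutI.induction_on with
    | of b g => exact ⟨_, hofP b g, by simp [PushoutI.twistProj]⟩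
    | base h =>
      exact ⟨_, hofP true (ψ true h), by
        simp [PushoutI.twistProj, ← PushoutI.of_apply_eq_base (infInclusion A B) true, ψ]⟩
    | mul x y hx hy =>
      obtain ⟨p, hp, rfl⟩ := hx
      obtain ⟨p', hp', rfl⟩ := hy
      exact ⟨p * p', mul_mem hp hp', map_mul _ _ _⟩
  · ext p
    have h1 : p ∈ π.ker ↔ (p : PushoutI (PushoutI.twist ψ χ)) ∈ (PushoutI.twistProj ψ χ).ker := by
      rw [MonoidHom.mem_ker, MonoidHom.mem_ker, ← map_eq_one_iff _ hinj]
      exact Subtype.ext_iff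
    rw [h1, PushoutI.twistProj_ker]
    constructor
    · rintro ⟨m, hm⟩
      exact ⟨⟨m, by change _ ∈ P; rw [hm]; exact p.2⟩, Subtype.ext hm⟩
    · rintro ⟨l, rfl⟩
      exact ⟨l, rfl⟩
  · rintro _ ⟨l, rfl⟩
    rw [Subgroup.mem_center_iff]
    intro p
    refine Subtype.ext ?_
    exact Subgroup.mem_center_iff.1 (PushoutI.twistIncl_mem_center (φ := ψ) χ (l : M))
      (p : PushoutI _)
  · let w : D → Additive L := fun d => Additive.ofMul ⟨φ (v d), hφL _⟩
    have hw : LinearIndependent ℤ w :=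
      LinearIndependent.of_comp (MonoidHom.toAdditive L.subtype).toIntLinearMap hv
    exact (Cardinal.aleph0_le_mk D).trans hw.cardinal_le_rank

/-- An amalgamated product of two finitely generated groups, such that the amalgamated subgroup has
an abelian quotient of infinite rank, is not finitely presented and has second homology of infinite
rank. -/
theorem IsInternalAmalgam.not_isFinitelyPresented_and_aleph0_le_rank {G M : Type u} [Group G]
    [CommGroup M] {A B K : Subgroup G} (hK : IsInternalAmalgam A B K) (hA : A.FG) (hB : B.FG)
    (φ : ↥(A ⊓ B) →* M) {D : Type u} [Infinite D] (v : D → ↥(A ⊓ B))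
    (hv : LinearIndependent ℤ fun d => Additive.ofMul (φ (v d))) :
    ¬ Group.IsFinitelyPresented K ∧ Cardinal.aleph0 ≤ Module.rank ℤ (integralH2 K) := by
  obtain ⟨hinj, rfl⟩ := hK
  obtain ⟨L, P, _, _, z, π, hP, hz, hπ, hker, hc, hL⟩ :=
    exists_central_extension_of_amalgam hA hB hinj φ v hv
  exact ⟨not_isFinitelyPresented_of_central_extension z π hz hπ hker hc hL,
    aleph0_le_rank_integralH2_of_central_extension z π hz hπ hker hc hL⟩

/-- A free group with an abelian quotient of infinite rank has infinite rank. -/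
theorem isFreeOfInfiniteRank_of_linearIndependent {N : Type u} [Group N] [IsFreeGroup N]
    {M D : Type*} [CommGroup M] [Infinite D] (φ : N →* M) (v : D → N)
    (hv : LinearIndependent ℤ fun d => Additive.ofMul (φ (v d))) : IsFreeOfInfiniteRank N := by
  refine ⟨IsFreeGroup.Generators N, ?_, ⟨IsFreeGroup.toFreeGroup N⟩⟩
  by_contra h
  rw [not_infinite_iff_finite] at h
  have : Group.FG N := Group.fg_of_surjective (f := (IsFreeGroup.toFreeGroup N).symm.toMonoidHom)
    (IsFreeGroup.toFreeGroup N).symm.surjective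
  have hw : LinearIndependent ℤ fun d => (Additive.ofMul (φ.rangeRestrict (v d))) :=
    LinearIndependent.of_comp (MonoidHom.toAdditive φ.range.subtype).toIntLinearMap hv
  have h1 := hw.cardinal_lift_le_rank
  have h2 := rank_additive_lt_aleph0 (L := φ.range)
  have h3 := Cardinal.aleph0_le_mk D
  have h4 := (Cardinal.aleph0_le_lift.2 h3).trans h1
  rw [Cardinal.aleph0_le_lift] at h4
  exact absurd h4 (not_le.2 h2)

/-! ### Subgroups of the factors of an amalgamated product -/

namespace Monoid.PushoutI

variable {G : Bool → Type*} {H K : Type*} [∀ b, Group (G b)] [Group H] [Group K]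
  {φ : ∀ b, H →* G b}

/-- Two subgroups of the factors of an amalgamated product that meet the amalgamated subgroup in the
same subgroup `T` have intersection `T`. -/
theorem map_of_inf_map_of (hφ : ∀ b, Function.Injective (φ b)) (j : PushoutI φ →* K)
    (hj : Function.Injective j) (S : ∀ b, Subgroup (G b)) (T : Subgroup H)
    (hT : ∀ b, (S b).comap (φ b) = T) :
    (S true).map (j.comp (of true)) ⊓ (S false).map (j.comp (of false)) =
      T.map (j.comp (base φ)) := by
  refine le_antisymm ?_ ?_
  · rintro x ⟨⟨s, hs, rfl⟩, ⟨s', hs', h⟩⟩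
    have h' : of false s' = of (φ := φ) true s := hj h
    have hmem : of (φ := φ) true s ∈ (base φ).range := by
      rw [← inf_of_range_eq_base_range hφ (i := true) (j := false) (by simp)]
      exact ⟨⟨s, rfl⟩, ⟨s', h'⟩⟩
    obtain ⟨t, ht⟩ := hmem
    refine ⟨t, ?_, congrArg j ht⟩
    rw [← of_apply_eq_base φ true] at ht
    rw [← hT true]
    change φ true t ∈ S true
    rw [of_injective hφ true ht]
    exact hs
  · rintro _ ⟨t, ht, rfl⟩
    have h : ∀ b, j (base φ t) ∈ (S b).map (j.comp (of b)) := fun b =>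
      ⟨φ b t, by rw [SetLike.mem_coe, ← hT b] at ht; exact ht,
        congrArg j (of_apply_eq_base φ b t)⟩
    exact ⟨h true, h false⟩

/-- Two subgroups of the factors of an amalgamated product that meet the amalgamated subgroup in the
same subgroup generate their amalgamated product. -/
theorem amalgamMap_injective (hφ : ∀ b, Function.Injective (φ b)) (j : PushoutI φ →* K)
    (hj : Function.Injective j) (S : ∀ b, Subgroup (G b)) (T : Subgroup H)
    (hT : ∀ b, (S b).comap (φ b) = T) :
    Function.Injective (amalgamMap ((S true).map (j.comp (of true)))
      ((S false).map (j.comp (of false)))) := by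
  set A := (S true).map (j.comp (of true)) with hA
  set B := (S false).map (j.comp (of false)) with hB
  have hinf : A ⊓ B = T.map (j.comp (base φ)) := map_of_inf_map_of hφ j hj S T hT
  have hjof : ∀ b, Function.Injective (j.comp (of (φ := φ) b)) := fun b =>
    hj.comp (of_injective hφ b)
  have hjb : Function.Injective (j.comp (base φ)) := hj.comp (base_injective hφ)
  -- The maps `f` and `k` pull the subgroups of `K` back to the factors and to the base group, where
  -- normal forms can be compared.
  have hex : ∀ b, ∃ f : subgroupPair A B b →* G b,
      ∀ g, f g ∈ S b ∧ j (of b (f g)) = g := by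
    have key : ∀ b, ∃ f : (S b).map (j.comp (of b)) →* G b,
        ∀ g, f g ∈ S b ∧ j (of b (f g)) = g := fun b => by
      let e := (S b).equivMapOfInjective _ (hjof b)
      refine ⟨(S b).subtype.comp e.symm.toMonoidHom, fun g => ⟨(e.symm g).2, ?_⟩⟩
      exact congrArg Subtype.val (e.apply_symm_apply g)
    rintro (_ | _)
    · exact key false
    · exact key true
  choose f hf using hex
  have hk : ∃ k : ↥(A ⊓ B) →* H, ∀ g, j (base φ (k g)) = g := by
    let e := T.equivMapOfInjective _ hjb
    refine ⟨(T.subtype.comp e.symm.toMonoidHom).comp (MulEquiv.subgroupCongr hinf).toMonoidHom,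
      fun g => ?_⟩
    exact congrArg Subtype.val (e.apply_symm_apply (MulEquiv.subgroupCongr hinf g))
  obtain ⟨k, hk⟩ := hk
  refine injective_of_comap_range_le f k hφ (infInclusion_injective A B) ?_ ?_ j hj _ ?_ ?_
  · intro a b h
    exact Subtype.ext (by rw [← hk a, ← hk b, h])
  · rintro b g ⟨t, ht⟩
    have h1 : (g : K) = j (base φ t) := by rw [← (hf b g).2, ← ht, of_apply_eq_base]
    have h2 : (g : K) ∈ A ⊓ B := by
      rw [hinf, h1]
      refine ⟨t, ?_, rfl⟩
      rw [← hT b]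
      change φ b t ∈ S b
      rw [ht]
      exact (hf b g).1
    exact ⟨⟨g, h2⟩, Subtype.ext rfl⟩
  · intro b g
    rw [amalgamMap_of, (hf b g).2]
  · intro g
    rw [amalgamMap_base, hk]

end Monoid.PushoutI

/-! ### Finite presentability of free products and surface groups -/

/-- The free product of two finitely presented subgroups is finitely presented. -/
theorem isFinitelyPresented_sup_of_amalgamMap_injective {G : Type*} [Group G] {A B : Subgroup G}
    (hAB : A ⊓ B = ⊥) (hinj : Function.Injective (amalgamMap A B))
    [Group.IsFinitelyPresented A] [Group.IsFinitelyPresented B] :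
    Group.IsFinitelyPresented ↥(A ⊔ B) := by
  let β : Coprod A B →* PushoutI (infInclusion A B) :=
    Coprod.lift (PushoutI.of (φ := infInclusion A B) true)
      (PushoutI.of (φ := infInclusion A B) false)
  let f : ∀ b, subgroupPair A B b →* Coprod A B := fun b => match b with
    | true => (Coprod.inl : A →* Coprod A B)
    | false => (Coprod.inr : B →* Coprod A B)
  let α : PushoutI (infInclusion A B) →* Coprod A B :=
    PushoutI.lift f 1 (fun b => by
      ext x
      have hx : x = 1 := Subtype.ext (by simpa [hAB] using x.2)
      rw [hx, map_one, map_one])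
  have hαf : ∀ b (g : subgroupPair A B b), α (PushoutI.of b g) = f b g := fun b g => by
    rw [PushoutI.lift_of]
  have hα : α.comp β = MonoidHom.id _ := by
    refine Coprod.hom_ext (MonoidHom.ext fun x => ?_) (MonoidHom.ext fun x => ?_)
    · exact hαf true x
    · exact hαf false x
  have hβ : Function.Injective β := fun x y h => by
    have := congrArg α h
    rwa [← MonoidHom.comp_apply, ← MonoidHom.comp_apply, hα] at this
  have hβ' : (amalgamMap A B).comp β = Coprod.lift A.subtype B.subtype := by
    refine Coprod.hom_ext ?_ ?_
    · ext x
      exact amalgamMap_of A B true x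
    · ext x
      exact amalgamMap_of A B false x
  have hr : ((amalgamMap A B).comp β).range = A ⊔ B := by
    rw [hβ', Coprod.range_lift, Subgroup.range_subtype, Subgroup.range_subtype]
  exact Group.IsFinitelyPresented.equiv
    ((MonoidHom.ofInjective (hinj.comp hβ : Function.Injective ((amalgamMap A B).comp β))).trans
      (MulEquiv.subgroupCongr hr))

theorem IsSurfaceGroup.isFinitelyPresented {S : Type*} [Group S] (hS : IsSurfaceGroup S) :
    Group.IsFinitelyPresented S := by
  obtain ⟨g, ⟨e⟩⟩ | ⟨k, -, ⟨e⟩⟩ | ⟨n, ⟨e⟩⟩ := hS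
  · exact Group.IsFinitelyPresented.equiv e.symm
  · exact Group.IsFinitelyPresented.equiv e.symm
  · exact Group.IsFinitelyPresented.equiv e.symm

instance Group.FG.of_isFinitelyPresented {G : Type*} [Group G] [h : Group.IsFinitelyPresented G] :
    Group.FG G := by
  obtain ⟨n, φ, hφ, -⟩ := h.out
  exact Group.fg_of_surjective hφ

/-! ### The symmetric quadrilateral as an iterated amalgam -/

namespace QuadrilateralOfGroups

section

variable {V : Type u} [Group V] (H₁ H₂ : Subgroup V)

/-- The homomorphism from a vertex group of the symmetric quadrilateral to its fundamental group. -/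
noncomputable def symmetricOf (i : ZMod 4) : V →* (symmetric H₁ H₂).FundamentalGroup :=
  (symmetric H₁ H₂).of i

theorem symmetric_of_eq (i : ZMod 4) {v : V} (hv : v ∈ if i = 1 ∨ i = 3 then H₁ else H₂) :
    symmetricOf H₁ H₂ (i - 1) v = symmetricOf H₁ H₂ i v :=
  (symmetric H₁ H₂).of_toPrev i ⟨v, hv⟩

/-- The amalgamated product of two adjacent vertex groups. -/
abbrev EdgeAmalgam : Type u :=
  PushoutI (fun _ : Bool => H₂.subtype)

/-- The inclusion of a vertex group in the amalgamated product along an edge. -/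
abbrev edgeOf (t : Bool) : V →* EdgeAmalgam H₂ :=
  PushoutI.of (G := fun _ => V) (φ := fun _ => H₂.subtype) t

/-- The homomorphism from the free product of the groups of two opposite edges to the amalgamated
product along another edge. -/
def edgesHom : CoprodI (fun _ : Bool => H₁) →* EdgeAmalgam H₂ :=
  CoprodI.lift fun b => (edgeOf H₂ b).comp H₁.subtype

theorem edgesHom_of (t : Bool) (h : H₁) :
    edgesHom H₁ H₂ (CoprodI.of (i := t) h) = edgeOf H₂ t h :=
  CoprodI.lift_of _ _

/-- Nontrivial elements of `H₁` avoid `H₂`, so an alternating word in them is already reduced in the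
edge amalgam. -/
theorem edgesHom_injective (hH : H₁ ⊓ H₂ = ⊥) : Function.Injective (edgesHom H₁ H₂) :=
  PushoutI.coprodI_lift_injective (φ := fun _ : Bool => H₂.subtype) (fun _ => H₁.subtype)
    (fun _ => H₂.subtype_injective) (fun _ g hg => by
      have : (g : V) ∈ H₁ ⊓ H₂ := ⟨g.2, by simpa using hg⟩
      rw [hH] at this
      exact Subtype.ext this)

/-- The fundamental group of the symmetric quadrilateral as an iterated amalgamated product. -/
abbrev IteratedAmalgam : Type u :=
  PushoutI (fun _ : Bool => edgesHom H₁ H₂)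

/-- The inclusion of an amalgamated product along an edge in the iterated amalgamated product. -/
abbrev iteratedOf (b : Bool) : EdgeAmalgam H₂ →* IteratedAmalgam H₁ H₂ :=
  PushoutI.of (G := fun _ => EdgeAmalgam H₂) (φ := fun _ => edgesHom H₁ H₂) b

/-- The vertices of the quadrilateral, indexed by the edge of type `H₂` that contains the vertex and
the position of the vertex on this edge. -/
def vertex : Bool → Bool → ZMod 4
  | true, true => 1
  | true, false => 2
  | false, false => 3
  | false, true => 4

/-- The homomorphism from the iterated amalgamated product to the fundamental group. -/
noncomputable def ofIteratedAmalgam :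
    IteratedAmalgam H₁ H₂ →* (symmetric H₁ H₂).FundamentalGroup :=
  PushoutI.lift
    (fun b => PushoutI.lift (fun t => symmetricOf H₁ H₂ (vertex b t))
      ((symmetricOf H₁ H₂ (vertex b true)).comp H₂.subtype) (by
        intro t
        ext h
        cases b <;> cases t
        · exact symmetric_of_eq H₁ H₂ 4 (by rw [if_neg (by decide)]; exact h.2)
        · rfl
        · exact (symmetric_of_eq H₁ H₂ 2 (by rw [if_neg (by decide)]; exact h.2)).symm
        · rfl))
    (CoprodI.lift fun t => (symmetricOf H₁ H₂ (vertex true t)).comp H₁.subtype) (by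
      intro b
      refine CoprodI.ext_hom _ _ fun t => ?_
      ext h
      simp only [MonoidHom.comp_apply, edgesHom, CoprodI.lift_of]
      cases b <;> cases t
      · exact (symmetric_of_eq H₁ H₂ 3 (by rw [if_pos (by decide)]; exact h.2)).symm
      · exact symmetric_of_eq H₁ H₂ 1 (by rw [if_pos (by decide)]; exact h.2)
      · rfl
      · rfl)

theorem ofIteratedAmalgam_of (b t : Bool) (v : V) :
    ofIteratedAmalgam H₁ H₂ (iteratedOf H₁ H₂ b (edgeOf H₂ t v)) =
      symmetricOf H₁ H₂ (vertex b t) v := by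
  rw [ofIteratedAmalgam, PushoutI.lift_of, PushoutI.lift_of]

/-- The homomorphism from a vertex group to the iterated amalgamated product. -/
def vertexHom : ZMod 4 → V →* IteratedAmalgam H₁ H₂
  | 0 => (iteratedOf H₁ H₂ false).comp (edgeOf H₂ true)
  | 1 => (iteratedOf H₁ H₂ true).comp (edgeOf H₂ true)
  | 2 => (iteratedOf H₁ H₂ true).comp (edgeOf H₂ false)
  | 3 => (iteratedOf H₁ H₂ false).comp (edgeOf H₂ false)

theorem vertexHom_vertex (b t : Bool) :
    vertexHom H₁ H₂ (vertex b t) = (iteratedOf H₁ H₂ b).comp (edgeOf H₂ t) := by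
  cases b <;> cases t <;> rfl

theorem vertexHom_compat_fst {v : V} (hv : v ∈ H₁) (t : Bool) :
    vertexHom H₁ H₂ (vertex false t) v = vertexHom H₁ H₂ (vertex true t) v := by
  have h : ∀ b, vertexHom H₁ H₂ (vertex b t) v =
      PushoutI.base (fun _ : Bool => edgesHom H₁ H₂) (CoprodI.of (i := t) (⟨v, hv⟩ : H₁)) := by
    intro b
    rw [vertexHom_vertex, ← PushoutI.of_apply_eq_base _ b, edgesHom_of]
    rfl
  rw [h, h]

theorem vertexHom_compat_snd {v : V} (hv : v ∈ H₂) (b : Bool) :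
    vertexHom H₁ H₂ (vertex b false) v = vertexHom H₁ H₂ (vertex b true) v := by
  have h : ∀ t, vertexHom H₁ H₂ (vertex b t) v =
      iteratedOf H₁ H₂ b (PushoutI.base (fun _ : Bool => H₂.subtype) ⟨v, hv⟩) := by
    intro t
    rw [vertexHom_vertex, ← PushoutI.of_apply_eq_base _ t]
    rfl
  rw [h, h]

/-- The homomorphism from the fundamental group to the iterated amalgamated product. -/
noncomputable def toIteratedAmalgam :
    (symmetric H₁ H₂).FundamentalGroup →* IteratedAmalgam H₁ H₂ :=
  (symmetric H₁ H₂).lift (vertexHom H₁ H₂) (by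
    have key : ∀ (i : ZMod 4) (v : V), v ∈ (if i = 1 ∨ i = 3 then H₁ else H₂) →
        vertexHom H₁ H₂ (i - 1) v = vertexHom H₁ H₂ i v := by
      intro i v hv
      match i with
      | 0 => exact vertexHom_compat_snd H₁ H₂ (by rwa [if_neg (by decide)] at hv) false
      | 1 => exact vertexHom_compat_fst H₁ H₂ (by rwa [if_pos (by decide)] at hv) true
      | 2 => exact (vertexHom_compat_snd H₁ H₂ (by rwa [if_neg (by decide)] at hv) true).symm
      | 3 => exact (vertexHom_compat_fst H₁ H₂ (by rwa [if_pos (by decide)] at hv) false).symm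
    exact fun i e => key i (Subgroup.subtype _ e)
      (show ↥(if i = 1 ∨ i = 3 then H₁ else H₂) from e).2)

theorem toIteratedAmalgam_ofIteratedAmalgam (x : IteratedAmalgam H₁ H₂) :
    toIteratedAmalgam H₁ H₂ (ofIteratedAmalgam H₁ H₂ x) = x := by
  have : (toIteratedAmalgam H₁ H₂).comp (ofIteratedAmalgam H₁ H₂) = MonoidHom.id _ := by
    refine PushoutI.hom_ext_nonempty fun b => PushoutI.hom_ext_nonempty fun t => ?_
    ext v
    simp only [MonoidHom.comp_apply, ofIteratedAmalgam_of]
    exact ((symmetric H₁ H₂).lift_of _ _ (vertex b t) v).trans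
      (DFunLike.congr_fun (vertexHom_vertex H₁ H₂ b t) v)
  exact DFunLike.congr_fun this x

/-- A one-sided inverse is enough: surjectivity is never needed, since the subgroups concerned are
described by their generators. -/
theorem ofIteratedAmalgam_injective : Function.Injective (ofIteratedAmalgam H₁ H₂) :=
  Function.LeftInverse.injective (toIteratedAmalgam_ofIteratedAmalgam H₁ H₂)

/-- The homomorphism to the fundamental group from the amalgamated product along an edge. -/
noncomputable def edgeAmalgamHom (b : Bool) :
    EdgeAmalgam H₂ →* (symmetric H₁ H₂).FundamentalGroup :=
  (ofIteratedAmalgam H₁ H₂).comp (iteratedOf H₁ H₂ b)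

theorem edgeAmalgamHom_of (b t : Bool) (v : V) :
    edgeAmalgamHom H₁ H₂ b (edgeOf H₂ t v) = symmetricOf H₁ H₂ (vertex b t) v :=
  ofIteratedAmalgam_of H₁ H₂ b t v

variable {H₁ H₂}

theorem edgeAmalgamHom_injective (hH : H₁ ⊓ H₂ = ⊥) (b : Bool) :
    Function.Injective (edgeAmalgamHom H₁ H₂ b) :=
  (ofIteratedAmalgam_injective H₁ H₂).comp
    (PushoutI.of_injective (fun _ => edgesHom_injective H₁ H₂ hH) b)

theorem exists_vertex_eq (i : ZMod 4) : ∃ b t, vertex b t = i := by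
  match i with
  | 0 => exact ⟨false, true, rfl⟩
  | 1 => exact ⟨true, true, rfl⟩
  | 2 => exact ⟨true, false, rfl⟩
  | 3 => exact ⟨false, false, rfl⟩

theorem symmetric_of_injective (hH : H₁ ⊓ H₂ = ⊥) (i : ZMod 4) :
    Function.Injective (symmetricOf H₁ H₂ i) := by
  obtain ⟨b, t, rfl⟩ := exists_vertex_eq i
  intro v w h
  have h' : symmetricOf H₁ H₂ (vertex b t) v = symmetricOf H₁ H₂ (vertex b t) w := h
  rw [← edgeAmalgamHom_of, ← edgeAmalgamHom_of] at h'
  exact PushoutI.of_injective (φ := fun _ : Bool => H₂.subtype)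
    (fun _ => H₂.subtype_injective) t (edgeAmalgamHom_injective hH b h')

end

end QuadrilateralOfGroups

/-! ### The copies of the normal subgroup inside an edge amalgam -/

namespace QuadrilateralOfGroups

section

variable {V : Type u} [Group V] {H₁ H₂ F : Subgroup V}

theorem comap_subtype_eq_bot {A B : Subgroup V} (h : A ⊓ B = ⊥) : A.comap B.subtype = ⊥ := by
  rw [eq_bot_iff]
  intro x hx
  have : (x : V) ∈ A ⊓ B := ⟨hx, x.2⟩
  rw [h] at this
  exact Subtype.ext this

/-- Both copies of `F` meet the amalgamated `H₂` trivially, so the amalgam they generate is over the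
trivial group. The embedding `j` is left arbitrary so that the two vertices can also be taken in the
opposite order. -/
theorem edgeAmalgam_free_product {K : Type*} [Group K] (hF : F ⊓ H₂ = ⊥)
    (j : EdgeAmalgam H₂ →* K) (hj : Function.Injective j) :
    F.map (j.comp (edgeOf H₂ true)) ⊓ F.map (j.comp (edgeOf H₂ false)) = ⊥ ∧
      Function.Injective (amalgamMap (F.map (j.comp (edgeOf H₂ true)))
        (F.map (j.comp (edgeOf H₂ false)))) := by
  have hT : ∀ _ : Bool, F.comap H₂.subtype = ⊥ := fun _ => comap_subtype_eq_bot hF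
  refine ⟨?_, PushoutI.amalgamMap_injective (φ := fun _ : Bool => H₂.subtype)
    (fun _ => H₂.subtype_injective) j hj (fun _ => F) ⊥ hT⟩
  rw [PushoutI.map_of_inf_map_of (φ := fun _ : Bool => H₂.subtype)
    (fun _ => H₂.subtype_injective) j hj (fun _ => F) ⊥ hT, Subgroup.map_bot]

/-- The automorphism of the amalgamated product along an edge that interchanges the two vertex
groups. -/
def edgeSwap (H₂ : Subgroup V) : EdgeAmalgam H₂ →* EdgeAmalgam H₂ :=
  PushoutI.lift (fun t => edgeOf H₂ (!t)) (PushoutI.base _)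
    (fun t => PushoutI.of_comp_eq_base (φ := fun _ : Bool => H₂.subtype) (!t))

theorem edgeSwap_of (t : Bool) (v : V) : edgeSwap H₂ (edgeOf H₂ t v) = edgeOf H₂ (!t) v :=
  PushoutI.lift_of _ _ _ _

theorem edgeSwap_injective : Function.Injective (edgeSwap H₂) := by
  have : (edgeSwap H₂).comp (edgeSwap H₂) = MonoidHom.id _ := by
    refine PushoutI.hom_ext_nonempty fun t => MonoidHom.ext fun v => ?_
    change edgeSwap H₂ (edgeSwap H₂ (edgeOf H₂ t v)) = edgeOf H₂ t v
    rw [edgeSwap_of, edgeSwap_of, Bool.not_not]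
  exact Function.LeftInverse.injective (g := edgeSwap H₂) fun x => DFunLike.congr_fun this x

/-- The subgroup of the amalgamated product along an edge generated by the copies of `F`. -/
def edgeSubgroup (H₂ F : Subgroup V) : Subgroup (EdgeAmalgam H₂) :=
  F.map (edgeOf H₂ true) ⊔ F.map (edgeOf H₂ false)

/-- The element `k` is the same in both vertex groups, so replacing `h` by `h * k⁻¹` in both copies
does not change the product. -/
theorem edgesHom_mem_edgeSubgroup (h : H₁) {k : V} (hk : k ∈ H₂) (hF : (h : V) * k⁻¹ ∈ F) :
    edgesHom H₁ H₂ (CoprodI.of (i := true) h * (CoprodI.of (i := false) h)⁻¹) ∈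
      edgeSubgroup H₂ F := by
  have hbase : edgeOf H₂ true k = edgeOf H₂ false k :=
    (PushoutI.of_apply_eq_base (fun _ : Bool => H₂.subtype) true ⟨k, hk⟩).trans
      (PushoutI.of_apply_eq_base (fun _ : Bool => H₂.subtype) false ⟨k, hk⟩).symm
  have : edgesHom H₁ H₂ (CoprodI.of (i := true) h * (CoprodI.of (i := false) h)⁻¹) =
      edgeOf H₂ true (h * k⁻¹) * (edgeOf H₂ false (h * k⁻¹))⁻¹ := by
    rw [map_mul, map_inv, edgesHom_of, edgesHom_of, map_mul, map_mul, map_inv, map_inv, hbase]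
    group
  rw [this]
  exact mul_mem (Subgroup.mem_sup_left ⟨_, hF, rfl⟩)
    (inv_mem (Subgroup.mem_sup_right ⟨_, hF, rfl⟩))

/-- A homomorphism that is trivial on `F` is trivial on the subgroup generated by the copies of
`F`. -/
theorem fold_eq_one_of_mem (hF : F ⊓ H₁ = ⊥) {Z : Type*} [Group Z] (q : V →* Z) (hq : q.ker = F)
    {c : CoprodI fun _ : Bool => H₁} (hc : edgesHom H₁ H₂ c ∈ edgeSubgroup H₂ F) :
    CoprodI.lift (fun _ => MonoidHom.id H₁) c = 1 := by
  -- Applying `q` on both vertex groups kills `edgeSubgroup H₂ F`. On `H₁ * H₁` it is folding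
  -- followed by `q`, and `q` is injective on `H₁`.
  let Q : EdgeAmalgam H₂ →* Z := PushoutI.lift (fun _ => q) (q.comp H₂.subtype) (fun _ => rfl)
  have hQ : ∀ t v, Q (edgeOf H₂ t v) = q v := fun t v => PushoutI.lift_of _ _ _ _
  have hle : edgeSubgroup H₂ F ≤ Q.ker := by
    refine sup_le ?_ ?_ <;>
    · rintro _ ⟨f, hf, rfl⟩
      rw [MonoidHom.mem_ker, hQ, ← MonoidHom.mem_ker, hq]
      exact hf
  have hcomp : Q.comp (edgesHom H₁ H₂) =
      (q.comp H₁.subtype).comp (CoprodI.lift fun _ => MonoidHom.id H₁) := by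
    refine CoprodI.ext_hom _ _ fun t => MonoidHom.ext fun h => ?_
    simp only [MonoidHom.comp_apply, CoprodI.lift_of, MonoidHom.id_apply, edgesHom_of, hQ]
    rfl
  have h1 : q (CoprodI.lift (fun _ => MonoidHom.id H₁) c : H₁) = 1 :=
    (DFunLike.congr_fun hcomp c).symm.trans (hle hc)
  have h2 : ((CoprodI.lift (fun _ => MonoidHom.id H₁) c : H₁) : V) ∈ F ⊓ H₁ :=
    ⟨hq ▸ MonoidHom.mem_ker.2 h1, Subtype.prop _⟩
  rw [hF] at h2
  exact Subtype.ext h2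

/-- Two infinite cyclic subgroups that embed in the infinite cyclic group `V / F` are commensurable
modulo `F`. -/
theorem infinite_commensurable (hcyc₁ : IsCyclic H₁) (hcyc₂ : IsCyclic H₂) (hinf₁ : Infinite H₁)
    (hinf₂ : Infinite H₂) (hF₂ : F ⊓ H₂ = ⊥) (q : V →* Multiplicative ℤ)
    (hq : q.ker = F) : {h : H₁ | ∃ k ∈ H₂, (h : V) * k⁻¹ ∈ F}.Infinite := by
  obtain ⟨h, hh⟩ := hcyc₁.exists_generator
  obtain ⟨k, hk⟩ := hcyc₂.exists_generator
  have hord : orderOf h = 0 := Infinite.orderOf_eq_zero_of_forall_mem_zpowers hh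
  have hkF : (q k).toAdd ≠ 0 := by
    intro h0
    have h1 : (k : V) ∈ F ⊓ H₂ := ⟨hq ▸ MonoidHom.mem_ker.2 h0, k.2⟩
    rw [hF₂] at h1
    have h2 : k = 1 := Subtype.ext h1
    have h3 : orderOf k = 0 := Infinite.orderOf_eq_zero_of_forall_mem_zpowers hk
    rw [h2, orderOf_one] at h3
    exact one_ne_zero h3
  -- The powers `h ^ (q k * i)` and `k ^ (q h * i)` have the same image `q h * q k * i` in `ℤ`, so
  -- they agree modulo `F`.
  have hinj : Function.Injective fun i : ℤ => h ^ ((q k).toAdd * i) :=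
    (injective_zpow_iff_not_isOfFinOrder.2 (orderOf_eq_zero_iff.1 hord)).comp
      (mul_right_injective₀ hkF)
  refine (Set.infinite_range_of_injective hinj).mono ?_
  rintro _ ⟨i, rfl⟩
  refine ⟨(k : V) ^ ((q h).toAdd * i), zpow_mem k.2 _, ?_⟩
  rw [← hq, MonoidHom.mem_ker]
  apply Multiplicative.toAdd.injective
  simp only [Subgroup.coe_zpow, map_mul, map_inv, map_zpow, toAdd_mul, toAdd_inv, toAdd_zpow,
    smul_eq_mul, toAdd_one]
  ring

end

end QuadrilateralOfGroups

open QuadrilateralOfGroups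

theorem mainTheorem6 {G₁ : Type u} [Group G₁] (H₁ H₂ F₁ : Subgroup G₁) [F₁.Normal]
    (hF₁ : IsSurfaceGroup F₁) (hquot : Nonempty (G₁ ⧸ F₁ ≃* Multiplicative ℤ))
    (hcyc₁ : IsCyclic H₁) (hcyc₂ : IsCyclic H₂) (hinf₁ : Infinite H₁) (hinf₂ : Infinite H₂)
    (hH : H₁ ⊓ H₂ = ⊥) (hFH₁ : F₁ ⊓ H₁ = ⊥) (hFH₂ : F₁ ⊓ H₂ = ⊥)
    (F : ZMod 4 → Subgroup (QuadrilateralOfGroups.symmetric H₁ H₂).FundamentalGroup)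
    (hF : ∀ i, F i = QuadrilateralOfGroups.symmetricCopy H₁ H₂ F₁ i) :
    (∀ i, Function.Injective ((QuadrilateralOfGroups.symmetric H₁ H₂).of i)) ∧
    (⨆ i, F i).FG ∧
    ¬ Group.IsFinitelyPresented ↥(⨆ i, F i) ∧
    ¬ IsCoherentGroup (QuadrilateralOfGroups.symmetric H₁ H₂).FundamentalGroup ∧
    (F 1 ⊓ F 2 = ⊥ ∧ IsInternalAmalgam (F 1) (F 2) (F 1 ⊔ F 2)) ∧
    (F 3 ⊓ F 4 = ⊥ ∧ IsInternalAmalgam (F 3) (F 4) (F 3 ⊔ F 4)) ∧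
    Group.IsFinitelyPresented ↥(F 1 ⊔ F 2) ∧
    Group.IsFinitelyPresented ↥(F 3 ⊔ F 4) ∧
    IsFreeOfInfiniteRank ↥((F 1 ⊔ F 2) ⊓ (F 3 ⊔ F 4)) ∧
    IsInternalAmalgam (F 1 ⊔ F 2) (F 3 ⊔ F 4) (⨆ i, F i) ∧
    Cardinal.aleph0 ≤ Module.rank ℤ (integralH2 ↥(⨆ i, F i)) := by
  have hof := symmetric_of_injective hH
  have hFi : ∀ b t, F (vertex b t) = F₁.map ((edgeAmalgamHom H₁ H₂ b).comp (edgeOf H₂ t)) := by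
    intro b t
    rw [hF]
    refine congrArg (fun f => Subgroup.map f F₁)
      (MonoidHom.ext fun v => (edgeAmalgamHom_of H₁ H₂ b t v).symm :
        symmetricOf H₁ H₂ (vertex b t) = _)
  have h1 : F 1 = _ := hFi true true
  have h2 : F 2 = _ := hFi true false
  have h3 : F 3 = _ := hFi false false
  have h4 : F 4 = _ := hFi false true
  have hfp : ∀ i, Group.IsFinitelyPresented (F i) := by
    intro i
    have := hF₁.isFinitelyPresented
    rw [hF]
    exact Group.IsFinitelyPresented.equiv (F₁.equivMapOfInjective _ (hof i))
  have hfg : ∀ i, (F i).FG := fun i => (Group.fg_iff_subgroup_fg _).1 inferInstance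
  have h12 : F 1 ⊓ F 2 = ⊥ ∧ IsInternalAmalgam (F 1) (F 2) (F 1 ⊔ F 2) := by
    obtain ⟨hbot, hinj⟩ := edgeAmalgam_free_product hFH₂ (edgeAmalgamHom H₁ H₂ true)
      (edgeAmalgamHom_injective hH true)
    rw [← h1, ← h2] at hbot hinj
    exact ⟨hbot, hinj, amalgamMap_range _ _⟩
  have h34 : F 3 ⊓ F 4 = ⊥ ∧ IsInternalAmalgam (F 3) (F 4) (F 3 ⊔ F 4) := by
    -- In this half the position `true` is vertex 4 and `false` is vertex 3; the swap puts the pair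
    -- in the order `F 3`, `F 4`.
    obtain ⟨hbot, hinj⟩ := edgeAmalgam_free_product hFH₂
      ((edgeAmalgamHom H₁ H₂ false).comp (edgeSwap H₂))
      ((edgeAmalgamHom_injective hH false).comp edgeSwap_injective)
    have hs : ∀ t, ((edgeAmalgamHom H₁ H₂ false).comp (edgeSwap H₂)).comp (edgeOf H₂ t) =
        (edgeAmalgamHom H₁ H₂ false).comp (edgeOf H₂ (!t)) := fun t =>
      MonoidHom.ext fun v => congrArg (edgeAmalgamHom H₁ H₂ false) (edgeSwap_of t v)
    rw [hs, hs, Bool.not_true, Bool.not_false, ← h3, ← h4] at hbot hinj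
    exact ⟨hbot, hinj, amalgamMap_range _ _⟩
  have hfp12 : Group.IsFinitelyPresented ↥(F 1 ⊔ F 2) :=
    isFinitelyPresented_sup_of_amalgamMap_injective h12.1 h12.2.1
  have hfp34 : Group.IsFinitelyPresented ↥(F 3 ⊔ F 4) :=
    isFinitelyPresented_sup_of_amalgamMap_injective h34.1 h34.2.1
  have hsup : (⨆ i, F i) = (F 1 ⊔ F 2) ⊔ (F 3 ⊔ F 4) := by
    refine le_antisymm (iSup_le fun i => ?_)
      (sup_le (sup_le (le_iSup F _) (le_iSup F _)) (sup_le (le_iSup F _) (le_iSup F _)))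
    match i with
    | 0 => exact le_sup_of_le_right le_sup_right
    | 1 => exact le_sup_of_le_left le_sup_left
    | 2 => exact le_sup_of_le_left le_sup_right
    | 3 => exact le_sup_of_le_right le_sup_left
  let ψ := edgesHom H₁ H₂
  have hψ : ∀ _ : Bool, Function.Injective ψ := fun _ => edgesHom_injective H₁ H₂ hH
  let S := edgeSubgroup H₂ F₁
  let T := S.comap ψ
  -- By symmetry both halves carry the same `S`, glued along the same map `ψ`, so the two traces on
  -- the amalgamated subgroup coincide by definition.
  have hA : F 1 ⊔ F 2 = S.map ((ofIteratedAmalgam H₁ H₂).comp (iteratedOf H₁ H₂ true)) := by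
    rw [h1, h2, ← Subgroup.map_map, ← Subgroup.map_map, ← Subgroup.map_sup]
    rfl
  have hB : F 3 ⊔ F 4 = S.map ((ofIteratedAmalgam H₁ H₂).comp (iteratedOf H₁ H₂ false)) := by
    rw [h3, h4, ← Subgroup.map_map, ← Subgroup.map_map, ← Subgroup.map_sup, sup_comm]
    rfl
  have hN : (F 1 ⊔ F 2) ⊓ (F 3 ⊔ F 4) =
      T.map ((ofIteratedAmalgam H₁ H₂).comp (PushoutI.base fun _ : Bool => ψ)) := by
    rw [hA, hB]
    exact PushoutI.map_of_inf_map_of hψ (ofIteratedAmalgam H₁ H₂)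
      (ofIteratedAmalgam_injective H₁ H₂) (fun _ => S) T fun _ => rfl
  have hamalg : IsInternalAmalgam (F 1 ⊔ F 2) (F 3 ⊔ F 4) (⨆ i, F i) := by
    rw [hsup]
    refine ⟨?_, amalgamMap_range _ _⟩
    rw [hA, hB]
    exact PushoutI.amalgamMap_injective hψ (ofIteratedAmalgam H₁ H₂)
      (ofIteratedAmalgam_injective H₁ H₂) (fun _ => S) T fun _ => rfl
  let e : T ≃* ↥((F 1 ⊔ F 2) ⊓ (F 3 ⊔ F 4)) :=
    (T.equivMapOfInjective _ ((ofIteratedAmalgam_injective H₁ H₂).comp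
      (PushoutI.base_injective hψ))).trans (MulEquiv.subgroupCongr hN.symm)
  obtain ⟨ρ⟩ := hquot
  let q : G₁ →* Multiplicative ℤ := ρ.toMonoidHom.comp (QuotientGroup.mk' F₁)
  have hq : q.ker = F₁ := by
    exact (MonoidHom.ker_mulEquiv_comp (QuotientGroup.mk' F₁) ρ).trans (QuotientGroup.ker_mk' F₁)
  let φ : T →* Multiplicative (H₁ →₀ ℤ) := lampHom T.subtype fun c =>
    fold_eq_one_of_mem hFH₁ q hq c.2
  -- The identity is removed because its difference of lamps is zero.
  let D : Set H₁ := {h : H₁ | ∃ k ∈ H₂, (h : G₁) * k⁻¹ ∈ F₁} \ {1}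
  have hD : Infinite D := Set.infinite_coe_iff.2 <|
    (infinite_commensurable hcyc₁ hcyc₂ hinf₁ hinf₂ hFH₂ q hq).sdiff (Set.finite_singleton 1)
  let v : D → T := fun d =>
    ⟨CoprodI.of (i := true) d.1 * (CoprodI.of (i := false) d.1)⁻¹, by
      obtain ⟨k, hk, hkF⟩ := d.2.1
      exact edgesHom_mem_edgeSubgroup d.1 hk hkF⟩
  have hv : LinearIndependent ℤ fun d => Additive.ofMul (φ (v d)) := by
    have hφv : ∀ d, φ (v d) = lamp 1 * (lamp (d : H₁))⁻¹ := fun d => lamplighterHom_left d.1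
    simp only [hφv]
    exact linearIndependent_lamp D fun h => h.2 rfl
  have hv' : LinearIndependent ℤ fun d =>
      Additive.ofMul ((φ.comp e.symm.toMonoidHom) (e (v d))) := by
    have : ∀ d, (φ.comp e.symm.toMonoidHom) (e (v d)) = φ (v d) := fun d =>
      congrArg φ (e.symm_apply_apply _)
    simp only [this]
    exact hv
  -- Freeness of `H₁` makes `H₁ * H₁` free, and its subgroup `T` is then free by Nielsen–Schreier.
  have hfree : IsFreeGroup H₁ := by
    obtain ⟨h, hh⟩ := hcyc₁.exists_generator
    exact IsFreeGroup.ofMulEquiv (FreeGroup.mulEquivIntOfUnique.trans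
      (intEquivOfZPowersEqTop h ((Subgroup.eq_top_iff' _).2 hh)) : FreeGroup Unit ≃* H₁)
  have hfreeN : IsFreeGroup ↥((F 1 ⊔ F 2) ⊓ (F 3 ⊔ F 4)) := IsFreeGroup.ofMulEquiv e
  obtain ⟨hnfp, hrank⟩ := hamalg.not_isFinitelyPresented_and_aleph0_le_rank
    ((hfg 1).sup (hfg 2)) ((hfg 3).sup (hfg 4)) (φ.comp e.symm.toMonoidHom) (fun d => e (v d)) hv'
  have hFG : (⨆ i, F i).FG := Subgroup.FG.iSup _ hfg
  exact ⟨hof, hFG, hnfp, fun hcoh => hnfp (hcoh _ hFG), h12, h34, hfp12, hfp34,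
    isFreeOfInfiniteRank_of_linearIndependent _ _ hv', hamalg, hrank⟩
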